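/- Let $K$ be a field and let $n\ge 2$ and $d\ge 1$ be integers. Let $L_K(n)$ be the Leavitt $K$-algebra, i.e. the unital associative $K$-algebra with generators $x_1,\dots,x_n,y_1,\dots,y_n$ and relations $y_ix_j=\delta_{ij}1$ for all $1\le i,j\le n$ and $\sum_{i=1}^n x_iy_i=1$, and let $\mathbb{M}_d(L_K(n))$ be the algebra of $d\times d$ matrices over it. For an associative $K$-algebra $R$ let $[R,R]$ be the $K$-subspace of $R$ spanned by all commutators $[a,b]=ab-ba$ with $a,b\in R$, regarded as a Lie $K$-algebra with the commutator bracket. A Lie $K$-algebra $L$ is called simple if $[L,L]\neq 0$ and its only Lie ideals ($K$-subspaces $I$ with $[L,I]\subseteq I$) are $0$ and $L$. Then the Lie $K$-algebra $$[\mathbb{M}_d(L_K(n)),\mathbb{M}_d(L_K(n))]$$ is simple if and only if $\mathrm{char}(K)$ divides $n-1$ and $\mathrm{char}(K)$ does not divide $d$. (In particular, it is never simple when $\mathrm{char}(K)=0$, as $0$ divides no nonzero integer.) -/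

import Mathlib

/-- The generators of the Leavitt algebra of type `(1, n)`: `x i` and `y i` for `i < n`. -/
inductive LeavittGen (n : ℕ) : Type
  | x (i : Fin n) : LeavittGen n
  | y (i : Fin n) : LeavittGen n

/-- The defining relations `y i * x j = δ i j` and `∑ i, x i * y i = 1`. -/
inductive LeavittRel (K : Type*) [Field K] (n : ℕ) :
    FreeAlgebra K (LeavittGen n) → FreeAlgebra K (LeavittGen n) → Prop
  | y_mul_x (i j : Fin n) : LeavittRel K n
      (FreeAlgebra.ι K (LeavittGen.y i) * FreeAlgebra.ι K (LeavittGen.x j))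
      (if i = j then 1 else 0)
  | sum_x_mul_y : LeavittRel K n
      (∑ i : Fin n, FreeAlgebra.ι K (LeavittGen.x i) * FreeAlgebra.ι K (LeavittGen.y i)) 1

/-- The classical Leavitt algebra `L_K(n)`: the unital associative `K`-algebra presented by
`x i`, `y i` (`i < n`) subject to `y i * x j = δ i j` and `∑ i, x i * y i = 1`. -/
def LeavittAlgebra (K : Type*) [Field K] (n : ℕ) : Type _ :=
  RingQuot (LeavittRel K n)

noncomputable instance LeavittAlgebra.instRing (K : Type*) [Field K] (n : ℕ) :
    Ring (LeavittAlgebra K n) :=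
  inferInstanceAs (Ring (RingQuot (LeavittRel K n)))

noncomputable instance LeavittAlgebra.instAlgebra (K : Type*) [Field K] (n : ℕ) :
    Algebra K (LeavittAlgebra K n) :=
  inferInstanceAs (Algebra K (RingQuot (LeavittRel K n)))

-- An associative algebra is a Lie algebra under `⁅a, b⁆ = a * b - b * a`.
attribute [local instance 100] LieRing.ofAssociativeRing

/-- The Lie `K`-algebra `[A, A]` associated to an associative `K`-algebra `A`: the span of all
commutators `a * b - b * a`, with the commutator bracket. -/
def commutatorLieAlgebra (K A : Type*) [Field K] [Ring A] [Algebra K A] : LieSubalgebra K A where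
  toSubmodule := Submodule.span K {c : A | ∃ a b : A, c = a * b - b * a}
  lie_mem' := fun {a b} _ _ =>
    Submodule.subset_span ⟨a, b, LieRing.of_associative_ring_bracket a b⟩

/-! Write `L = L_K(n)`.

* A Lie ideal of `[M_ι(S), M_ι(S)]`, for `S` central simple and `ι` of size at least three, is
  either scalar or everything: from a nonscalar element, brackets with matrix units produce first a
  single off-diagonal entry and then, as `S` is simple, every off-diagonal matrix `single i j s`.
  Hence this Lie algebra is simple as soon as `1` is not a sum of commutators, and an identity
  that is a sum of commutators is a nonzero central element.
* `L` is central simple: after compression by long words, an element becomes a combination of pure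
  words in the `x i` or in the `y i`, and compression by a word `i ⋯ i j` without borders then
  leaves only its scalar part. As `L ≃ M_n(L)`, the size of the matrices may be taken large.
* A matrix is a sum of commutators iff its trace is, so the question is whether `d • 1 ∈ [L, L]`.
  Since `∑ i, [x i, y i] = 1 - n`, this holds if `n ≠ 1` in `K`. If `n = 1` in `K`, iterating
  `a ↦ ∑ i, y i * a * x i` moves every element into the span of the pure words, where it preserves
  the scalar part; the eventual scalar part vanishes on commutators but not on `1`.
-/

theorem isSimple_of_lieEquiv {K L M : Type*} [CommRing K] [LieRing L] [LieAlgebra K L]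
    [LieRing M] [LieAlgebra K M] (e : L ≃ₗ⁅K⁆ M) (h : LieAlgebra.IsSimple K M) :
    LieAlgebra.IsSimple K L where
  non_abelian hL := h.non_abelian ((lie_abelian_iff_equiv_lie_abelian e).1 hL)
  eq_bot_or_eq_top I := by
    have comap_comap : (I.comap (e.symm : M →ₗ⁅K⁆ L)).comap (e : L →ₗ⁅K⁆ M) = I := by
      ext v
      simp [LieIdeal.mem_comap]
    rw [← comap_comap]
    refine (h.eq_bot_or_eq_top (I.comap (e.symm : M →ₗ⁅K⁆ L))).imp ?_ ?_ <;>
    · intro hI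
      ext v
      simp [hI, LieIdeal.mem_comap]

namespace commutatorLieAlgebra

section Functoriality

variable {K A B : Type*} [Field K] [Ring A] [Algebra K A] [Ring B] [Algebra K B]

theorem mul_sub_mul_mem (a b : A) : a * b - b * a ∈ commutatorLieAlgebra K A :=
  Submodule.subset_span ⟨a, b, rfl⟩

theorem toSubmodule_le {U : Submodule K A} (h : ∀ a b : A, a * b - b * a ∈ U) :
    (commutatorLieAlgebra K A).toSubmodule ≤ U :=
  Submodule.span_le.2 fun _ ⟨a, b, hab⟩ => hab ▸ h a b

theorem map_mem (f : A →ₐ[K] B) {a : A} (ha : a ∈ commutatorLieAlgebra K A) :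
    f a ∈ commutatorLieAlgebra K B := by
  refine toSubmodule_le (U := (commutatorLieAlgebra K B).toSubmodule.comap f.toLinearMap)
    (fun a b => ?_) ha
  simpa using mul_sub_mul_mem (K := K) (f a) (f b)

theorem map_algEquiv (e : A ≃ₐ[K] B) :
    (commutatorLieAlgebra K A).map (e.toLieEquiv : A →ₗ⁅K⁆ B) = commutatorLieAlgebra K B := by
  ext b
  constructor
  · rintro ⟨a, ha, rfl⟩
    exact map_mem (e : A →ₐ[K] B) ha
  · intro hb
    exact ⟨e.symm b, map_mem (e.symm : B →ₐ[K] A) hb, e.apply_symm_apply b⟩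

theorem isSimple_of_algEquiv (e : A ≃ₐ[K] B)
    (h : LieAlgebra.IsSimple K (commutatorLieAlgebra K B)) :
    LieAlgebra.IsSimple K (commutatorLieAlgebra K A) :=
  isSimple_of_lieEquiv (e.toLieEquiv.ofSubalgebras _ _ (map_algEquiv e)) h

theorem one_notMem_of_isSimple (h : LieAlgebra.IsSimple K (commutatorLieAlgebra K A)) :
    (1 : A) ∉ commutatorLieAlgebra K A := by
  intro h1
  have one_mem_center : (⟨1, h1⟩ : commutatorLieAlgebra K A) ∈
      LieAlgebra.center K (commutatorLieAlgebra K A) := by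
    rw [LieModule.mem_maxTrivSubmodule]
    intro v
    ext
    simp [LieRing.of_associative_ring_bracket]
  rw [LieAlgebra.center_eq_bot, LieSubmodule.mem_bot] at one_mem_center
  have : Subsingleton A :=
    subsingleton_of_zero_eq_one (congrArg Subtype.val one_mem_center).symm
  exact h.non_abelian ⟨fun _ _ => Subsingleton.elim _ _⟩

end Functoriality

section MatrixAlgebra

open Matrix

variable {K S ι : Type*} [Field K] [Ring S] [Algebra K S] [Fintype ι] [DecidableEq ι]

theorem single_mem {i j : ι} (hij : i ≠ j) (s : S) :
    single i j s ∈ commutatorLieAlgebra K (Matrix ι ι S) := by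
  have h := mul_sub_mul_mem (K := K) (single i i (1 : S)) (single i j s)
  rwa [single_mul_single_same, single_mul_single_of_ne _ _ _ _ hij.symm, sub_zero, one_mul] at h

theorem single_sub_single_mem (i j : ι) (a b : S) :
    single i i (a * b) - single j j (b * a) ∈ commutatorLieAlgebra K (Matrix ι ι S) := by
  have h := mul_sub_mul_mem (K := K) (single i j a) (single j i b)
  rwa [single_mul_single_same, single_mul_single_same] at h

theorem trace_mem {A : Matrix ι ι S} (hA : A ∈ commutatorLieAlgebra K (Matrix ι ι S)) :
    A.trace ∈ commutatorLieAlgebra K S := by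
  refine toSubmodule_le
    (U := (commutatorLieAlgebra K S).toSubmodule.comap (traceLinearMap ι K S)) (fun A B => ?_) hA
  have trace_eq : (A * B - B * A).trace = ∑ i, ∑ j, (A i j * B j i - B j i * A i j) := by
    simp only [trace_sub, Finset.sum_sub_distrib]
    exact congrArg _ Finset.sum_comm
  rw [Submodule.mem_comap, traceLinearMap_apply, trace_eq]
  exact Submodule.sum_mem _ fun i _ => Submodule.sum_mem _ fun j _ => mul_sub_mul_mem _ _

/-- Modulo `U`, a matrix is congruent to its trace, moved to a single diagonal position. -/
theorem mem_of_trace_mem {U : Submodule K (Matrix ι ι S)}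
    (hoff : ∀ i j, i ≠ j → ∀ s, single i j s ∈ U)
    (hdiag : ∀ i j a b, single i i (a * b) - single j j (b * a) ∈ U)
    {A : Matrix ι ι S} (hA : A.trace ∈ commutatorLieAlgebra K S) : A ∈ U := by
  cases isEmpty_or_nonempty ι with
  | inl _ => rw [Subsingleton.elim A 0]; exact U.zero_mem
  | inr hι =>
    obtain ⟨k⟩ := hι
    have trace_part_mem : single k k A.trace ∈ U := by
      refine toSubmodule_le (U := U.comap (singleLinearMap K k k)) (fun a b => ?_) hA
      rw [Submodule.mem_comap, map_sub]
      exact hdiag k k a b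
    have entry_mem (i j : ι) :
        single i j (A i j) - (if i = j then single k k (A i j) else 0) ∈ U := by
      split_ifs with hij
      · subst hij
        simpa using hdiag i k (A i i) 1
      · simpa using hoff i j hij (A i j)
    have decomposition : A = ∑ i, ∑ j, (single i j (A i j) -
        (if i = j then single k k (A i j) else 0)) + single k k A.trace := by
      have : single k k A.trace = ∑ i, single k k (A i i) :=
        map_sum (singleLinearMap K k k) (fun i => A i i) Finset.univ
      simp only [Finset.sum_sub_distrib, Finset.sum_ite_eq, Finset.mem_univ, if_true, this,
        sub_add_cancel]
      exact matrix_eq_sum_single A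
    rw [decomposition]
    exact U.add_mem (U.sum_mem fun i _ => U.sum_mem fun j _ => entry_mem i j) trace_part_mem

theorem mem_matrix_iff_trace_mem {A : Matrix ι ι S} :
    A ∈ commutatorLieAlgebra K (Matrix ι ι S) ↔ A.trace ∈ commutatorLieAlgebra K S :=
  ⟨trace_mem, mem_of_trace_mem (U := (commutatorLieAlgebra K (Matrix ι ι S)).toSubmodule)
    (fun _ _ hij => single_mem hij) single_sub_single_mem⟩

variable {U : Submodule K (Matrix ι ι S)}

theorem single_mul_apply_mul_mem (hι : 3 ≤ ENat.card ι)
    (hU : ∀ u ∈ U, ∀ v ∈ commutatorLieAlgebra K (Matrix ι ι S), u * v - v * u ∈ U)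
    {u : Matrix ι ι S} (hu : u ∈ U) {p q : ι} (hpq : p ≠ q) (a b : S) :
    single q p (a * u p q * b) ∈ U := by
  obtain ⟨i, hip, hiq⟩ := ENat.exists_ne_ne_of_three_le hι p q
  have triple := hU _ (hU _ (hU _ hu _ (single_mem hiq.symm b)) _ (single_mem hpq.symm a)) _
    (single_mem hip 1)
  have hXY : single q i b * single q p a = 0 := single_mul_single_of_ne _ _ _ _ hiq _
  have hYX : single q p a * single q i b = 0 := single_mul_single_of_ne _ _ _ _ hpq _
  have hYZ : single q p a * single i p (1 : S) = 0 := single_mul_single_of_ne _ _ _ _ hip.symm _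
  have hZY : single i p (1 : S) * single q p a = 0 := single_mul_single_of_ne _ _ _ _ hpq _
  have hZX : single i p (1 : S) * single q i b = 0 := single_mul_single_of_ne _ _ _ _ hpq _
  have hYuXZ :
      single q p a * u * (single q i b * single i p 1) = single q p (a * u p q * b) := by
    rw [single_mul_single_same, single_mul_mul_single, mul_one]
  generalize single q i b = X, single q p a = Y, single i p (1 : S) = Z at *
  have triple_eq : ((u * X - X * u) * Y - Y * (u * X - X * u)) * Z -
      Z * ((u * X - X * u) * Y - Y * (u * X - X * u)) = -(Y * u * (X * Z)) := by
    calc _ = u * (X * Y) * Z - X * u * (Y * Z) - Y * u * (X * Z) + (Y * X) * u * Z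
          - Z * u * (X * Y) + (Z * X) * u * Y + (Z * Y) * u * X - (Z * Y) * X * u := by
            noncomm_ring
      _ = _ := by rw [hXY, hYX, hYZ, hZY, hZX]; simp
  rwa [triple_eq, hYuXZ, U.neg_mem_iff] at triple

theorem single_mem_of_apply_ne_zero [IsSimpleRing S] (hι : 3 ≤ ENat.card ι)
    (hU : ∀ u ∈ U, ∀ v ∈ commutatorLieAlgebra K (Matrix ι ι S), u * v - v * u ∈ U)
    {u : Matrix ι ι S} (hu : u ∈ U) {p q : ι} (hpq : p ≠ q) (hupq : u p q ≠ 0) (s : S) :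
    single q p s ∈ U := by
  let J : TwoSidedIdeal S := .mk' {t | ∀ a b, single q p (a * t * b) ∈ U}
    (by simp)
    (fun {t t'} ht ht' a b => by
      rw [mul_add, add_mul, single_add]; exact U.add_mem (ht a b) (ht' a b))
    (fun {t} ht a b => by
      rw [mul_neg, neg_mul, ← single_neg]; exact U.neg_mem (ht a b))
    (fun {r t} ht a b => by simpa only [mul_assoc] using ht (a * r) b)
    (fun {t r} ht a b => by simpa only [mul_assoc] using ht a (r * b))
  have mem_J {t : S} : t ∈ J ↔ ∀ a b, single q p (a * t * b) ∈ U := TwoSidedIdeal.mem_mk' ..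
  have entry_mem_J : u p q ∈ J := mem_J.2 (single_mul_apply_mul_mem hι hU hu hpq)
  have one_mem_J : (1 : S) ∈ J := IsSimpleRing.one_mem_of_ne_zero_mem J hupq entry_mem_J
  simpa using mem_J.1 one_mem_J s 1

theorem single_mem_row
    (hU : ∀ u ∈ U, ∀ v ∈ commutatorLieAlgebra K (Matrix ι ι S), u * v - v * u ∈ U)
    {p q j : ι} (hqj : q ≠ j) (h : ∀ s, single q p s ∈ U) (s : S) : single q j s ∈ U := by
  by_cases hpj : p = j
  · exact hpj ▸ h s
  have bracket := hU _ (h s) _ (single_mem hpj 1)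
  rwa [single_mul_single_same, single_mul_single_of_ne _ _ _ _ hqj.symm, sub_zero, mul_one]
    at bracket

theorem single_mem_col
    (hU : ∀ u ∈ U, ∀ v ∈ commutatorLieAlgebra K (Matrix ι ι S), u * v - v * u ∈ U)
    {p q i : ι} (hip : i ≠ p) (h : ∀ s, single q p s ∈ U) (s : S) : single i p s ∈ U := by
  by_cases hiq : i = q
  · exact hiq ▸ h s
  have bracket := hU _ (h s) _ (single_mem hiq 1)
  rwa [single_mul_single_same, single_mul_single_of_ne _ _ _ _ hip.symm, zero_sub, one_mul,
    U.neg_mem_iff] at bracket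

theorem toSubmodule_le_of_forall_single_mem (hι : 3 ≤ ENat.card ι)
    (hU : ∀ u ∈ U, ∀ v ∈ commutatorLieAlgebra K (Matrix ι ι S), u * v - v * u ∈ U)
    {p q : ι} (h : ∀ s, single q p s ∈ U) :
    (commutatorLieAlgebra K (Matrix ι ι S)).toSubmodule ≤ U := by
  have hoff (i j : ι) (hij : i ≠ j) (s : S) : single i j s ∈ U := by
    obtain ⟨r, hrq, hri⟩ := ENat.exists_ne_ne_of_three_le hι q i
    exact single_mem_row hU hij (single_mem_col hU hri.symm (single_mem_row hU hrq.symm h)) s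
  have hdiag_of_ne {i j : ι} (hij : i ≠ j) (a b : S) :
      single i i (a * b) - single j j (b * a) ∈ U := by
    have bracket := hU _ (hoff i j hij a) _ (single_mem hij.symm b)
    rwa [single_mul_single_same, single_mul_single_same] at bracket
  have hdiag (i j : ι) (a b : S) : single i i (a * b) - single j j (b * a) ∈ U := by
    obtain ⟨r, hri, hrj⟩ := ENat.exists_ne_ne_of_three_le hι i j
    simpa using U.add_mem (hdiag_of_ne hri.symm a b) (hdiag_of_ne hrj (b * a) 1)
  exact fun A hA => mem_of_trace_mem hoff hdiag (trace_mem hA)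

theorem mem_one_of_isDiag [Algebra.IsCentral K S] (hι : 3 ≤ ENat.card ι)
    (hU : ∀ u ∈ U, ∀ v ∈ commutatorLieAlgebra K (Matrix ι ι S), u * v - v * u ∈ U)
    (hdiag : ∀ u ∈ U, u.IsDiag) {u : Matrix ι ι S} (hu : u ∈ U) :
    u ∈ (1 : Submodule K (Matrix ι ι S)) := by
  have mul_single_eq {i j : ι} (hij : i ≠ j) (s : S) : u i i * s = s * u j j := by
    have bracket : (u * single i j s - single i j s * u) i j = 0 :=
      hdiag _ (hU u hu _ (single_mem hij s)) hij
    rwa [Matrix.sub_apply, mul_single_apply_same, single_mul_apply_same, sub_eq_zero] at bracket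
  have diag_eq (i j : ι) : u i i = u j j := by
    obtain rfl | hij := eq_or_ne i j
    · rfl
    · simpa using mul_single_eq hij 1
  cases isEmpty_or_nonempty ι with
  | inl _ => rw [Subsingleton.elim u 0]; exact zero_mem _
  | inr hne =>
    obtain ⟨i⟩ := hne
    obtain ⟨j, hji, -⟩ := ENat.exists_ne_ne_of_three_le hι i i
    have central : u i i ∈ Subalgebra.center K S :=
      Subalgebra.mem_center_iff.2 fun s => by rw [mul_single_eq hji.symm s, diag_eq i j]
    rw [Algebra.IsCentral.center_eq_bot, Algebra.mem_bot] at central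
    obtain ⟨c, hc⟩ := central
    refine Submodule.mem_one.2 ⟨c, ?_⟩
    ext p q
    obtain rfl | hpq := eq_or_ne p q
    · rw [algebraMap_matrix_apply, if_pos rfl, hc, diag_eq]
    · rw [algebraMap_matrix_apply, if_neg hpq, hdiag u hu hpq]

theorem le_one_or_toSubmodule_le [IsSimpleRing S] [Algebra.IsCentral K S] (hι : 3 ≤ ENat.card ι)
    (hU : ∀ u ∈ U, ∀ v ∈ commutatorLieAlgebra K (Matrix ι ι S), u * v - v * u ∈ U) :
    U ≤ 1 ∨ (commutatorLieAlgebra K (Matrix ι ι S)).toSubmodule ≤ U := by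
  by_cases hdiag : ∀ u ∈ U, u.IsDiag
  · exact .inl fun u hu => mem_one_of_isDiag hι hU hdiag hu
  · simp only [IsDiag, Pairwise, not_forall] at hdiag
    obtain ⟨u, hu, p, q, hpq, hupq⟩ := hdiag
    exact .inr <| toSubmodule_le_of_forall_single_mem hι hU
      (single_mem_of_apply_ne_zero hι hU hu hpq hupq)

theorem not_isLieAbelian_matrix [Nontrivial S] (hι : 3 ≤ ENat.card ι) :
    ¬ IsLieAbelian (commutatorLieAlgebra K (Matrix ι ι S)) := by
  intro habelian
  have : Nonempty ι := by
    by_contra! hempty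
    simp at hι
  obtain ⟨i⟩ := this
  obtain ⟨j, hji, -⟩ := ENat.exists_ne_ne_of_three_le hι i i
  obtain ⟨k, hki, hkj⟩ := ENat.exists_ne_ne_of_three_le hι i j
  have bracket : single i j (1 : S) * single j k 1 - single j k 1 * single i j 1 = 0 :=
    congrArg Subtype.val (habelian.trivial ⟨_, single_mem (K := K) hji.symm (1 : S)⟩
      ⟨_, single_mem hkj.symm 1⟩)
  rw [single_mul_single_same, single_mul_single_of_ne _ _ _ _ hki, sub_zero, mul_one]
    at bracket
  simpa using congrFun₂ bracket i k

theorem isSimple_matrix_of_one_notMem [IsSimpleRing S] [Algebra.IsCentral K S]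
    (hι : 3 ≤ ENat.card ι) (h1 : (1 : Matrix ι ι S) ∉ commutatorLieAlgebra K (Matrix ι ι S)) :
    LieAlgebra.IsSimple K (commutatorLieAlgebra K (Matrix ι ι S)) where
  non_abelian := not_isLieAbelian_matrix hι
  eq_bot_or_eq_top I := by
    let U : Submodule K (Matrix ι ι S) :=
      I.toSubmodule.map (commutatorLieAlgebra K (Matrix ι ι S)).toSubmodule.subtype
    have mem_U (v : commutatorLieAlgebra K (Matrix ι ι S)) : v.1 ∈ U ↔ v ∈ I :=
      Subtype.val_injective.mem_set_image
    have hU : ∀ u ∈ U, ∀ v ∈ commutatorLieAlgebra K (Matrix ι ι S), u * v - v * u ∈ U := by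
      rintro _ ⟨u, hu, rfl⟩ v hv
      exact ⟨_, lie_mem_left K _ I u ⟨v, hv⟩ hu, rfl⟩
    refine (le_one_or_toSubmodule_le hι hU).imp (fun hle => ?_) (fun hle => ?_)
    · rw [LieSubmodule.eq_bot_iff]
      intro v hv
      obtain ⟨c, hc⟩ := Submodule.mem_one.1 (hle ((mem_U v).2 hv))
      by_contra hv0
      have hc0 : c ≠ 0 := by
        rintro rfl
        exact hv0 (Subtype.ext (by rw [← hc, map_zero]; rfl))
      refine h1 ((Submodule.smul_mem_iff
        (commutatorLieAlgebra K (Matrix ι ι S)).toSubmodule hc0).1 ?_)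
      rw [← Algebra.algebraMap_eq_smul_one, hc]
      exact v.2
    · exact eq_top_iff.2 fun v _ => (mem_U v).1 (hle v.2)

end MatrixAlgebra

end commutatorLieAlgebra

/-- The vectors killed by `u k` for all `k` sufficiently far along the filter `l`. -/
def eventualKer {ι R M N : Type*} [Semiring R] [AddCommMonoid M] [Module R M] [AddCommMonoid N]
    [Module R N] (l : Filter ι) (u : ι → M →ₗ[R] N) : Submodule R M where
  carrier := {v | ∀ᶠ k in l, u k v = 0}
  zero_mem' := by simp
  add_mem' {v w} hv hw := by
    filter_upwards [hv, hw] with k hvk hwk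
    rw [map_add, hvk, hwk, add_zero]
  smul_mem' c v hv := by
    filter_upwards [hv] with k hvk
    rw [map_smul, hvk, smul_zero]

namespace LeavittAlgebra

section Generators

variable (K : Type*) [Field K] {n : ℕ}

/-- The generator `x i` of the Leavitt algebra. -/
noncomputable def x (i : Fin n) : LeavittAlgebra K n :=
  RingQuot.mkAlgHom K (LeavittRel K n) (FreeAlgebra.ι K (LeavittGen.x i))

/-- The generator `y i` of the Leavitt algebra. -/
noncomputable def y (i : Fin n) : LeavittAlgebra K n :=
  RingQuot.mkAlgHom K (LeavittRel K n) (FreeAlgebra.ι K (LeavittGen.y i))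

theorem y_mul_x (i j : Fin n) : y K i * x K j = if i = j then 1 else 0 := by
  have h := RingQuot.mkAlgHom_rel K (LeavittRel.y_mul_x (K := K) i j)
  rwa [map_mul, apply_ite (RingQuot.mkAlgHom K (LeavittRel K n)), map_one, map_zero] at h

theorem sum_x_mul_y : ∑ i : Fin n, x K i * y K i = 1 := by
  have h := RingQuot.mkAlgHom_rel K (LeavittRel.sum_x_mul_y (K := K) (n := n))
  simp only [map_sum, map_mul, map_one] at h
  exact h

variable {K} in
@[elab_as_elim]
theorem induction_on {p : LeavittAlgebra K n → Prop}
    (algebraMap : ∀ c : K, p (algebraMap K _ c)) (x : ∀ i, p (x K i)) (y : ∀ i, p (y K i))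
    (mul : ∀ a b, p a → p b → p (a * b)) (add : ∀ a b, p a → p b → p (a + b))
    (a : LeavittAlgebra K n) : p a := by
  obtain ⟨a, rfl⟩ := RingQuot.mkAlgHom_surjective K (LeavittRel K n) a
  induction a using FreeAlgebra.induction with
  | grade0 c => rw [AlgHom.commutes]; exact algebraMap c
  | grade1 g =>
    cases g with
    | x i => exact x i
    | y i => exact y i
  | mul a b ha hb => rw [map_mul]; exact mul _ _ ha hb
  | add a b ha hb => rw [map_add]; exact add _ _ ha hb

variable {A : Type*} [Ring A] [Algebra K A] {a b : Fin n → A}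

theorem freeAlgebra_lift_eq_of_rel (hba : ∀ i j, b i * a j = if i = j then 1 else 0)
    (hab : ∑ i, a i * b i = 1) ⦃u v : FreeAlgebra K (LeavittGen n)⦄ (h : LeavittRel K n u v) :
    FreeAlgebra.lift K (fun g => (LeavittGen.casesOn g a b : A)) u =
      FreeAlgebra.lift K (fun g => (LeavittGen.casesOn g a b : A)) v := by
  cases h with
  | y_mul_x i j =>
    rw [map_mul, FreeAlgebra.lift_ι_apply, FreeAlgebra.lift_ι_apply,
      apply_ite (FreeAlgebra.lift K _), map_one, map_zero]
    exact hba i j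
  | sum_x_mul_y =>
    simp only [map_sum, map_one, map_mul, FreeAlgebra.lift_ι_apply]
    exact hab

/-- The universal property of the Leavitt algebra. -/
noncomputable def lift (hba : ∀ i j, b i * a j = if i = j then 1 else 0)
    (hab : ∑ i, a i * b i = 1) : LeavittAlgebra K n →ₐ[K] A :=
  RingQuot.liftAlgHom K ⟨_, freeAlgebra_lift_eq_of_rel K hba hab⟩

theorem lift_x (hba : ∀ i j, b i * a j = if i = j then 1 else 0) (hab : ∑ i, a i * b i = 1)
    (i : Fin n) : lift K hba hab (x K i) = a i :=
  (RingQuot.liftAlgHom_mkAlgHom_apply K _ (freeAlgebra_lift_eq_of_rel K hba hab) _).trans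
    (FreeAlgebra.lift_ι_apply _ _)

theorem lift_y (hba : ∀ i j, b i * a j = if i = j then 1 else 0) (hab : ∑ i, a i * b i = 1)
    (i : Fin n) : lift K hba hab (y K i) = b i :=
  (RingQuot.liftAlgHom_mkAlgHom_apply K _ (freeAlgebra_lift_eq_of_rel K hba hab) _).trans
    (FreeAlgebra.lift_ι_apply _ _)

end Generators

section Words

variable (K : Type*) [Field K] {n : ℕ}

/-- The monomial `x i₁ * ⋯ * x iₖ` attached to the word `[i₁, …, iₖ]`. -/
noncomputable def xWord (w : List (Fin n)) : LeavittAlgebra K n := (w.map (x K)).prod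

/-- The monomial `y iₖ * ⋯ * y i₁` attached to the word `[i₁, …, iₖ]`; the order is reversed so
that it is a left inverse of `xWord K w`. -/
noncomputable def yWord (w : List (Fin n)) : LeavittAlgebra K n := (w.reverse.map (y K)).prod

@[simp] theorem xWord_nil : xWord K ([] : List (Fin n)) = 1 := rfl

@[simp] theorem yWord_nil : yWord K ([] : List (Fin n)) = 1 := rfl

theorem xWord_cons (i : Fin n) (w : List (Fin n)) : xWord K (i :: w) = x K i * xWord K w := by
  simp [xWord]

theorem yWord_cons (i : Fin n) (w : List (Fin n)) : yWord K (i :: w) = yWord K w * y K i := by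
  simp [yWord]

theorem xWord_append (u v : List (Fin n)) : xWord K (u ++ v) = xWord K u * xWord K v := by
  simp [xWord]

theorem yWord_append (u v : List (Fin n)) : yWord K (u ++ v) = yWord K v * yWord K u := by
  simp [yWord]

theorem yWord_cons_mul_xWord_cons (i j : Fin n) (u v : List (Fin n)) :
    yWord K (i :: u) * xWord K (j :: v) = if i = j then yWord K u * xWord K v else 0 := by
  rw [yWord_cons, xWord_cons, mul_assoc, ← mul_assoc (y K i), y_mul_x]
  split_ifs <;> simp

@[simp]
theorem yWord_mul_xWord_self (w : List (Fin n)) : yWord K w * xWord K w = 1 := by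
  induction w with
  | nil => simp
  | cons i w ih => rw [yWord_cons_mul_xWord_cons, if_pos rfl, ih]

theorem yWord_mul_xWord_append (u v : List (Fin n)) :
    yWord K u * xWord K (u ++ v) = xWord K v := by
  rw [xWord_append, ← mul_assoc, yWord_mul_xWord_self, one_mul]

theorem yWord_append_mul_xWord (u v : List (Fin n)) :
    yWord K (u ++ v) * xWord K u = yWord K v := by
  rw [yWord_append, mul_assoc, yWord_mul_xWord_self, mul_one]

theorem yWord_mul_xWord_eq_zero {u v : List (Fin n)} (huv : ¬ u <+: v) (hvu : ¬ v <+: u) :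
    yWord K u * xWord K v = 0 := by
  induction u generalizing v with
  | nil => exact absurd List.nil_prefix huv
  | cons i u ih =>
    cases v with
    | nil => exact absurd List.nil_prefix hvu
    | cons j v =>
      rw [yWord_cons_mul_xWord_cons]
      split_ifs with hij
      · subst hij
        exact ih (by simpa using huv) (by simpa using hvu)
      · rfl

/-- The span of the monomials in the `x i` of degree at least `m`. -/
noncomputable def xSpan (n m : ℕ) : Submodule K (LeavittAlgebra K n) :=
  Submodule.span K (xWord K '' {w | m ≤ w.length})

/-- The span of the monomials that involve only the `x i` or only the `y i`. -/
noncomputable def pureSpan (n : ℕ) : Submodule K (LeavittAlgebra K n) :=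
  Submodule.span K (Set.range (xWord K) ∪ Set.range (yWord K))

variable {K}

theorem xWord_mem_pureSpan (w : List (Fin n)) : xWord K w ∈ pureSpan K n :=
  Submodule.subset_span (.inl ⟨w, rfl⟩)

theorem yWord_mem_pureSpan (w : List (Fin n)) : yWord K w ∈ pureSpan K n :=
  Submodule.subset_span (.inr ⟨w, rfl⟩)

theorem yWord_mul_xWord_mem_pureSpan (u v : List (Fin n)) :
    yWord K u * xWord K v ∈ pureSpan K n := by
  by_cases huv : u <+: v
  · obtain ⟨t, rfl⟩ := huv
    exact yWord_mul_xWord_append K u t ▸ xWord_mem_pureSpan t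
  by_cases hvu : v <+: u
  · obtain ⟨t, rfl⟩ := hvu
    exact yWord_append_mul_xWord K v t ▸ yWord_mem_pureSpan t
  · exact yWord_mul_xWord_eq_zero K huv hvu ▸ Submodule.zero_mem _

theorem yWord_mul_mem_pureSpan (u : List (Fin n)) {m : ℕ} {f : LeavittAlgebra K n}
    (hf : f ∈ xSpan K n m) : yWord K u * f ∈ pureSpan K n := by
  have hle : xSpan K n m ≤ (pureSpan K n).comap (LinearMap.mulLeft K (yWord K u)) :=
    Submodule.span_le.2 <| Set.image_subset_iff.2 fun v _ => yWord_mul_xWord_mem_pureSpan u v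
  exact hle hf

theorem xSpan_antitone : Antitone (xSpan K n) := fun _ _ hm =>
  Submodule.span_mono (Set.image_mono fun _ => hm.trans)

theorem x_mul_mem_xSpan (i : Fin n) {m : ℕ} {f : LeavittAlgebra K n} (hf : f ∈ xSpan K n m) :
    x K i * f ∈ xSpan K n m := by
  have hle : xSpan K n m ≤ (xSpan K n m).comap (LinearMap.mulLeft K (x K i)) :=
    Submodule.span_le.2 <| Set.image_subset_iff.2 fun w hw =>
      Submodule.subset_span ⟨i :: w, Nat.le_succ_of_le hw, xWord_cons K i w⟩
  exact hle hf

theorem y_mul_mem_xSpan (i : Fin n) {m : ℕ} {f : LeavittAlgebra K n}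
    (hf : f ∈ xSpan K n (m + 1)) : y K i * f ∈ xSpan K n m := by
  have hle : xSpan K n (m + 1) ≤ (xSpan K n m).comap (LinearMap.mulLeft K (y K i)) := by
    refine Submodule.span_le.2 <| Set.image_subset_iff.2 fun w hw => ?_
    obtain ⟨j, w, rfl⟩ := List.exists_cons_of_length_pos (Nat.zero_lt_of_lt hw)
    suffices y K i * xWord K (j :: w) ∈ xSpan K n m from this
    rw [xWord_cons, ← mul_assoc, y_mul_x, ite_mul, one_mul, zero_mul]
    split_ifs
    · exact Submodule.subset_span ⟨w, Nat.le_of_succ_le_succ hw, rfl⟩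
    · exact Submodule.zero_mem _
  exact hle hf

theorem exists_forall_mul_mem_xSpan (a : LeavittAlgebra K n) :
    ∃ N, ∀ m, ∀ f ∈ xSpan K n (m + N), a * f ∈ xSpan K n m := by
  induction a using induction_on with
  | algebraMap c =>
    exact ⟨0, fun m f hf => by rw [← Algebra.smul_def]; exact Submodule.smul_mem _ c hf⟩
  | x i => exact ⟨0, fun m f hf => x_mul_mem_xSpan i hf⟩
  | y i => exact ⟨1, fun m f hf => y_mul_mem_xSpan i hf⟩
  | mul a b ha hb =>
    obtain ⟨N, hN⟩ := ha
    obtain ⟨N', hN'⟩ := hb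
    refine ⟨N + N', fun m f hf => ?_⟩
    rw [mul_assoc]
    exact hN m _ (hN' (m + N) f (by rwa [add_assoc]))
  | add a b ha hb =>
    obtain ⟨N, hN⟩ := ha
    obtain ⟨N', hN'⟩ := hb
    refine ⟨max N N', fun m f hf => ?_⟩
    rw [add_mul]
    exact Submodule.add_mem _ (hN m f (xSpan_antitone (by lia) hf))
      (hN' m f (xSpan_antitone (by lia) hf))

theorem exists_forall_mul_xWord_mem_xSpan (a : LeavittAlgebra K n) :
    ∃ N, ∀ w : List (Fin n), N ≤ w.length → a * xWord K w ∈ xSpan K n 0 := by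
  obtain ⟨N, hN⟩ := exists_forall_mul_mem_xSpan a
  exact ⟨N, fun w hw => hN 0 _ (Submodule.subset_span ⟨w, by simpa using hw, rfl⟩)⟩

theorem exists_mul_xWord_ne_zero {a : LeavittAlgebra K n} (ha : a ≠ 0) (N : ℕ) :
    ∃ w : List (Fin n), w.length = N ∧ a * xWord K w ≠ 0 := by
  induction N generalizing a with
  | zero => exact ⟨[], rfl, by simpa using ha⟩
  | succ N ih =>
    have exists_mul_x_ne_zero : ∃ i, a * x K i ≠ 0 := by
      by_contra! hzero
      refine ha ?_
      rw [← mul_one a, ← sum_x_mul_y, Finset.mul_sum]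
      exact Finset.sum_eq_zero fun i _ => by rw [← mul_assoc, hzero i, zero_mul]
    obtain ⟨i, hi⟩ := exists_mul_x_ne_zero
    obtain ⟨w, hw, hne⟩ := ih hi
    exact ⟨i :: w, by simp [hw], by rwa [xWord_cons, ← mul_assoc]⟩

end Words

section ScalarPart

variable (K : Type*) [Field K] {n : ℕ}

section Digits

variable [NeZero n]

/-- The operator on functions `ℕ → K` that sends the indicator of `m` to the indicator of
`m * n + i`, that is, appends the digit `i` to the base `n` expansion of `m`. -/
def appendDigit (i : Fin n) : Module.End K (ℕ → K) where
  toFun f m := if (Nat.divModEquiv n m).2 = i then f (Nat.divModEquiv n m).1 else 0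
  map_add' f g := by ext m; simp [ite_add_zero]
  map_smul' c f := by ext m; simp

/-- The operator on functions `ℕ → K` that sends the indicator of `m * n + i` to the indicator
of `m`, and kills the indicators of the numbers whose last base `n` digit is not `i`. -/
def dropDigit (i : Fin n) : Module.End K (ℕ → K) :=
  LinearMap.funLeft K K fun m => (Nat.divModEquiv n).symm (m, i)

theorem appendDigit_apply (i : Fin n) (f : ℕ → K) (m : ℕ) : appendDigit K i f m =
    if (Nat.divModEquiv n m).2 = i then f (Nat.divModEquiv n m).1 else 0 := rfl

theorem dropDigit_apply (i : Fin n) (f : ℕ → K) (m : ℕ) :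
    dropDigit K i f m = f ((Nat.divModEquiv n).symm (m, i)) := rfl

theorem dropDigit_mul_appendDigit (i j : Fin n) :
    dropDigit K i * appendDigit K j = if i = j then 1 else 0 := by
  ext f m
  rw [Module.End.mul_apply, dropDigit_apply, appendDigit_apply, Equiv.apply_symm_apply]
  split_ifs <;> rfl

theorem sum_appendDigit_mul_dropDigit :
    ∑ i : Fin n, appendDigit K i * dropDigit K i = 1 := by
  ext f m
  simp only [LinearMap.sum_apply, Module.End.mul_apply, Finset.sum_apply, appendDigit_apply,
    dropDigit_apply, Finset.sum_ite_eq, Finset.mem_univ, if_true, Prod.mk.eta,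
    Equiv.symm_apply_apply, Module.End.one_apply]

variable (n) in
/-- The representation of the Leavitt algebra on functions `ℕ → K` by base `n` digits. -/
noncomputable def digitRep : LeavittAlgebra K n →ₐ[K] Module.End K (ℕ → K) :=
  lift K (dropDigit_mul_appendDigit K) (sum_appendDigit_mul_dropDigit K)

variable (n) in
/-- The matrix coefficient of `digitRep K n` at the number `1`. On `pureSpan K n` it reads off
the coefficient of the empty monomial when `2 ≤ n`. -/
noncomputable def scalarPart : LeavittAlgebra K n →ₗ[K] K :=
  LinearMap.proj 1 ∘ₗ LinearMap.applyₗ (Pi.single 1 1) ∘ₗ (digitRep K n).toLinearMap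

theorem scalarPart_apply (a : LeavittAlgebra K n) :
    scalarPart K n a = digitRep K n a (Pi.single 1 1) 1 := rfl

@[simp]
theorem scalarPart_one : scalarPart K n 1 = 1 := by
  simp [scalarPart_apply]

end Digits

variable [n.AtLeastTwo]

theorem digitRep_xWord_apply_zero {f : ℕ → K} (hf : f 0 = 0) (w : List (Fin n)) :
    digitRep K n (xWord K w) f 0 = 0 := by
  induction w with
  | nil => simpa using hf
  | cons i w ih =>
    rw [xWord_cons, map_mul, Module.End.mul_apply, digitRep, lift_x, appendDigit_apply, ← digitRep]
    simp [ih]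

theorem digitRep_yWord_apply_eq_zero {f : ℕ → K} (hf : ∀ m ≠ 0, f m = 0) (w : List (Fin n))
    {m : ℕ} (hm : m ≠ 0) : digitRep K n (yWord K w) f m = 0 := by
  induction w generalizing f with
  | nil => simpa using hf m hm
  | cons i w ih =>
    rw [yWord_cons, map_mul, Module.End.mul_apply]
    refine ih fun k hk => ?_
    rw [digitRep, lift_y, dropDigit_apply]
    exact hf _ (by simp [hk, NeZero.ne])

@[simp]
theorem scalarPart_xWord_cons (i : Fin n) (w : List (Fin n)) :
    scalarPart K n (xWord K (i :: w)) = 0 := by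
  have one_div : 1 / n = 0 := Nat.div_eq_of_lt Nat.AtLeastTwo.one_lt
  rw [scalarPart_apply, xWord_cons, map_mul, Module.End.mul_apply, digitRep, lift_x,
    appendDigit_apply, ← digitRep]
  simp [one_div, digitRep_xWord_apply_zero]

@[simp]
theorem scalarPart_yWord_cons (i : Fin n) (w : List (Fin n)) :
    scalarPart K n (yWord K (i :: w)) = 0 := by
  rw [scalarPart_apply, yWord_cons, map_mul, Module.End.mul_apply]
  refine digitRep_yWord_apply_eq_zero K (fun m hm => ?_) w one_ne_zero
  have one_lt : 1 < m * n + i := by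
    nlinarith [Nat.pos_of_ne_zero hm, Nat.AtLeastTwo.one_lt (n := n)]
  rw [digitRep, lift_y, dropDigit_apply]
  exact Pi.single_eq_of_ne one_lt.ne' _

theorem exists_scalarPart_yWord_mul_ne_zero {m : ℕ} {f : LeavittAlgebra K n}
    (hf : f ∈ xSpan K n m) (hf0 : f ≠ 0) : ∃ u, scalarPart K n (yWord K u * f) ≠ 0 := by
  obtain ⟨c, -, rfl⟩ := (Finsupp.mem_span_image_iff_linearCombination K).1 hf
  have support_nonempty : c.support.Nonempty := by
    rw [Finsupp.support_nonempty_iff]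
    rintro rfl
    exact hf0 (map_zero _)
  obtain ⟨u, hu, hmin⟩ := c.support.exists_min_image List.length support_nonempty
  have scalarPart_eq_zero (v : List (Fin n)) (hv : v ∈ c.support) (hvu : v ≠ u) :
      scalarPart K n (yWord K u * xWord K v) = 0 := by
    by_cases huv : u <+: v
    · obtain ⟨_ | ⟨i, t⟩, rfl⟩ := huv
      · simp at hvu
      · rw [yWord_mul_xWord_append, scalarPart_xWord_cons]
    · rw [yWord_mul_xWord_eq_zero K huv fun h =>
        hvu (h.eq_of_length_le (hmin v hv)), map_zero]
  refine ⟨u, ?_⟩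
  rw [Finsupp.linearCombination_apply, Finsupp.sum, Finset.mul_sum, map_sum,
    Finset.sum_eq_single_of_mem u hu]
  · simpa using hu
  · intro v hv hvu
    rw [mul_smul_comm, map_smul, scalarPart_eq_zero v hv hvu, smul_zero]

end ScalarPart

section Simplicity

variable {K : Type*} [Field K] {n : ℕ}

/-- The word `i ⋯ i j` with `k` letters `i`. For `i ≠ j` it has no border, so compressing by it
kills the nonempty pure monomials of degree at most `k`. -/
def probe (i j : Fin n) (k : ℕ) : List (Fin n) := List.replicate k i ++ [j]

theorem not_probe_prefix_append {i j : Fin n} (hij : i ≠ j) {k : ℕ} {t : List (Fin n)}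
    (ht : t ≠ []) (htk : t.length ≤ k) : ¬ probe i j k <+: t ++ probe i j k := by
  intro hprefix
  have ht0 : 0 < t.length := List.length_pos_iff.2 ht
  have letter_eq := hprefix.getElem (i := k) (by simp [probe])
  rw [List.getElem_append_right htk] at letter_eq
  exact hij (by simpa [probe, ht0, ht0.trans_le htk] using letter_eq.symm)

theorem not_append_prefix {α : Type*} {t u : List α} (ht : t ≠ []) : ¬ t ++ u <+: u :=
  fun hprefix => ht (by simpa using hprefix.length_le)

variable [n.AtLeastTwo]

theorem eventually_yWord_probe_mul_mul_xWord_probe {i j : Fin n} (hij : i ≠ j)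
    {b : LeavittAlgebra K n} (hb : b ∈ pureSpan K n) :
    ∀ᶠ k in Filter.atTop, yWord K (probe i j k) * b * xWord K (probe i j k) =
      algebraMap K _ (scalarPart K n b) := by
  let u (k : ℕ) : LeavittAlgebra K n →ₗ[K] LeavittAlgebra K n :=
    LinearMap.mulRight K (xWord K (probe i j k)) ∘ₗ LinearMap.mulLeft K (yWord K (probe i j k)) -
      Algebra.linearMap K _ ∘ₗ scalarPart K n
  have u_apply (k : ℕ) (b : LeavittAlgebra K n) : u k b =
      yWord K (probe i j k) * b * xWord K (probe i j k) -
        algebraMap K _ (scalarPart K n b) := rfl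
  have hle : pureSpan K n ≤ eventualKer Filter.atTop u := by
    refine Submodule.span_le.2 (Set.union_subset ?_ ?_) <;> rintro _ ⟨t, rfl⟩ <;>
      filter_upwards [Filter.eventually_ge_atTop t.length] with k hk <;>
      rw [u_apply] <;> obtain _ | ⟨l, t⟩ := t
    · simp
    · rw [mul_assoc, ← xWord_append, yWord_mul_xWord_eq_zero K
        (not_probe_prefix_append hij (by simp) hk) (not_append_prefix (by simp))]
      simp
    · simp
    · rw [← yWord_append, yWord_mul_xWord_eq_zero K (not_append_prefix (by simp))
        (not_probe_prefix_append hij (by simp) hk)]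
      simp
  exact (hle hb).mono fun k hk => sub_eq_zero.1 hk

theorem exists_yWord_mul_mul_xWord_eq_scalarPart {b : LeavittAlgebra K n}
    (hb : b ∈ pureSpan K n) :
    ∃ w, yWord K w * b * xWord K w = algebraMap K _ (scalarPart K n b) := by
  obtain ⟨i, j, hij⟩ := exists_pair_ne (Fin n)
  obtain ⟨k, hk⟩ := (eventually_yWord_probe_mul_mul_xWord_probe hij hb).exists
  exact ⟨_, hk⟩

theorem exists_mul_mul_eq_one {s : LeavittAlgebra K n} (hs : s ≠ 0) : ∃ a b, a * s * b = 1 := by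
  obtain ⟨N, hN⟩ := exists_forall_mul_xWord_mem_xSpan s
  obtain ⟨v, hv, hsv⟩ := exists_mul_xWord_ne_zero hs N
  have mem_xSpan := hN v hv.ge
  obtain ⟨u, hu⟩ := exists_scalarPart_yWord_mul_ne_zero K mem_xSpan hsv
  obtain ⟨w, hw⟩ := exists_yWord_mul_mul_xWord_eq_scalarPart (yWord_mul_mem_pureSpan u mem_xSpan)
  set c := scalarPart K n (yWord K u * (s * xWord K v))
  refine ⟨c⁻¹ • (yWord K w * yWord K u), xWord K v * xWord K w, ?_⟩
  calc c⁻¹ • (yWord K w * yWord K u) * s * (xWord K v * xWord K w)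
      = c⁻¹ • (yWord K w * (yWord K u * (s * xWord K v)) * xWord K w) := by
        simp only [smul_mul_assoc, mul_assoc]
    _ = 1 := by rw [hw, Algebra.algebraMap_eq_smul_one, smul_smul, inv_mul_cancel₀ hu, one_smul]

instance isSimpleRing : IsSimpleRing (LeavittAlgebra K n) := by
  have : Nontrivial (LeavittAlgebra K n) :=
    ⟨1, 0, fun h => one_ne_zero (α := K) (by rw [← scalarPart_one K (n := n), h, map_zero])⟩
  refine .of_eq_bot_or_eq_top fun I => or_iff_not_imp_left.2 fun hI => ?_
  obtain ⟨s, hs, hs0⟩ := SetLike.exists_of_lt (bot_lt_iff_ne_bot.2 hI)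
  obtain ⟨a, b, hab⟩ := exists_mul_mul_eq_one (mt (TwoSidedIdeal.mem_bot _).2 hs0)
  exact I.one_mem_iff.1 (hab ▸ I.mul_mem_right _ b (I.mul_mem_left a s hs))

instance isCentral : Algebra.IsCentral K (LeavittAlgebra K n) where
  out c hc := by
    have conj_eq (w : List (Fin n)) : yWord K w * c * xWord K w = c := by
      rw [Subalgebra.mem_center_iff.1 hc, mul_assoc, yWord_mul_xWord_self, mul_one]
    obtain ⟨N, hN⟩ := exists_forall_mul_xWord_mem_xSpan c
    have mem_pureSpan : c ∈ pureSpan K n := by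
      rw [← conj_eq (List.replicate N 0), mul_assoc]
      exact yWord_mul_mem_pureSpan _ (hN _ (by simp))
    obtain ⟨w, hw⟩ := exists_yWord_mul_mul_xWord_eq_scalarPart mem_pureSpan
    exact Algebra.mem_bot.2 ⟨_, hw.symm.trans (conj_eq w)⟩

end Simplicity

section Transfer

variable (K : Type*) [Field K] (n : ℕ)

/-- The operator `a ↦ ∑ i, y i * a * x i`. Every commutator with a generator is, up to sign, of the
form `a - transfer K n a`. -/
noncomputable def transfer : LeavittAlgebra K n →ₗ[K] LeavittAlgebra K n :=
  ∑ i, LinearMap.mulRight K (x K i) ∘ₗ LinearMap.mulLeft K (y K i)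

variable {K n}

theorem transfer_apply (a : LeavittAlgebra K n) : transfer K n a = ∑ i, y K i * a * x K i := by
  simp [transfer]

theorem transfer_x_mul (i : Fin n) (a : LeavittAlgebra K n) :
    transfer K n (x K i * a) = a * x K i := by
  simp [transfer_apply, ← mul_assoc, y_mul_x]

theorem transfer_mul_y (i : Fin n) (a : LeavittAlgebra K n) :
    transfer K n (a * y K i) = y K i * a := by
  simp [transfer_apply, mul_assoc, y_mul_x]

theorem transfer_one : transfer K n 1 = (n : K) • 1 := by
  simp [transfer_apply, y_mul_x, Nat.cast_smul_eq_nsmul]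

theorem transfer_xWord_cons (i : Fin n) (w : List (Fin n)) :
    transfer K n (xWord K (i :: w)) = xWord K (w ++ [i]) := by
  rw [xWord_cons, transfer_x_mul, xWord_append, xWord_cons, xWord_nil, mul_one]

theorem transfer_yWord_cons (i : Fin n) (w : List (Fin n)) :
    transfer K n (yWord K (i :: w)) = yWord K (w ++ [i]) := by
  rw [yWord_cons, transfer_mul_y, yWord_append, yWord_cons, yWord_nil, one_mul]

theorem transfer_pow_mem {W : Submodule K (LeavittAlgebra K n)} {k : ℕ} {a : LeavittAlgebra K n}
    (h : ∀ w : List (Fin n), w.length = k → yWord K w * a * xWord K w ∈ W) :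
    (transfer K n ^ k) a ∈ W := by
  induction k generalizing a with
  | zero => simpa using h []
  | succ k ih =>
    rw [pow_succ, Module.End.mul_apply]
    refine ih fun w hw => ?_
    rw [transfer_apply, Finset.mul_sum, Finset.sum_mul]
    refine W.sum_mem fun i _ => ?_
    simpa only [yWord_cons, xWord_cons, mul_assoc] using h (i :: w) (by simp [hw])

theorem eventually_transfer_pow_mem_pureSpan (a : LeavittAlgebra K n) :
    ∀ᶠ k in Filter.atTop, (transfer K n ^ k) a ∈ pureSpan K n := by
  obtain ⟨N, hN⟩ := exists_forall_mul_xWord_mem_xSpan a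
  filter_upwards [Filter.eventually_ge_atTop N] with k hk
  refine transfer_pow_mem fun w hw => ?_
  rw [mul_assoc]
  exact yWord_mul_mem_pureSpan w (hN w (hw ▸ hk))

variable [n.AtLeastTwo]

theorem scalarPart_transfer (hn : (n : K) = 1) {b : LeavittAlgebra K n}
    (hb : b ∈ pureSpan K n) : scalarPart K n (transfer K n b) = scalarPart K n b := by
  refine LinearMap.eqOn_span (f := scalarPart K n ∘ₗ transfer K n) ?_ hb
  rintro _ (⟨_ | ⟨i, w⟩, rfl⟩ | ⟨_ | ⟨i, w⟩, rfl⟩)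
  · simp [transfer_one, hn]
  · rw [LinearMap.comp_apply, transfer_xWord_cons, scalarPart_xWord_cons]
    cases w <;> simp
  · simp [transfer_one, hn]
  · rw [LinearMap.comp_apply, transfer_yWord_cons, scalarPart_yWord_cons]
    cases w <;> simp

theorem sub_transfer_mem_eventualKer (hn : (n : K) = 1) (a : LeavittAlgebra K n) :
    a - transfer K n a ∈
      eventualKer Filter.atTop fun k => scalarPart K n ∘ₗ transfer K n ^ k := by
  filter_upwards [eventually_transfer_pow_mem_pureSpan a] with k hk
  rw [LinearMap.comp_apply, map_sub, ← Module.End.mul_apply, ← pow_succ, pow_succ',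
    Module.End.mul_apply, map_sub, scalarPart_transfer hn hk, sub_self]

theorem mul_sub_mul_mem_eventualKer (hn : (n : K) = 1) (a b : LeavittAlgebra K n) :
    a * b - b * a ∈ eventualKer Filter.atTop fun k => scalarPart K n ∘ₗ transfer K n ^ k := by
  induction a using induction_on generalizing b with
  | algebraMap c => rw [Algebra.commutes, sub_self]; exact Submodule.zero_mem _
  | x i => simpa only [transfer_x_mul] using sub_transfer_mem_eventualKer hn (x K i * b)
  | y i =>
    rw [← neg_sub]
    simpa only [transfer_mul_y] using
      Submodule.neg_mem _ (sub_transfer_mem_eventualKer hn (b * y K i))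
  | mul a a' ha ha' =>
    have split : a * a' * b - b * (a * a') =
        (a * (a' * b) - a' * b * a) + (a' * (b * a) - b * a * a') := by noncomm_ring
    exact split ▸ Submodule.add_mem _ (ha _) (ha' _)
  | add a a' ha ha' =>
    have split : (a + a') * b - b * (a + a') = (a * b - b * a) + (a' * b - b * a') := by
      noncomm_ring
    exact split ▸ Submodule.add_mem _ (ha b) (ha' b)

theorem one_notMem_commutatorLieAlgebra (hn : (n : K) = 1) :
    (1 : LeavittAlgebra K n) ∉ commutatorLieAlgebra K (LeavittAlgebra K n) := by
  intro h1
  have one_mem := commutatorLieAlgebra.toSubmodule_le (mul_sub_mul_mem_eventualKer hn) h1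
  obtain ⟨k, hk⟩ := Filter.Eventually.exists one_mem
  have transfer_pow_one : (transfer K n ^ k) 1 = 1 := by
    rw [Module.End.pow_apply]
    exact Function.iterate_fixed (by rw [transfer_one, hn, one_smul]) k
  rw [LinearMap.comp_apply, transfer_pow_one, scalarPart_one] at hk
  exact one_ne_zero hk

end Transfer

section Main

variable {K : Type*} [Field K] {n : ℕ} {ι : Type*} [Fintype ι] [DecidableEq ι]

theorem one_mem_commutatorLieAlgebra_iff [n.AtLeastTwo] :
    (1 : LeavittAlgebra K n) ∈ commutatorLieAlgebra K (LeavittAlgebra K n) ↔ (n : K) ≠ 1 := by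
  refine ⟨fun h1 hn => one_notMem_commutatorLieAlgebra hn h1, fun hn => ?_⟩
  have sum_commutators : ∑ i : Fin n, (x K i * y K i - y K i * x K i) =
      (1 - (n : K)) • (1 : LeavittAlgebra K n) := by
    simp [sum_x_mul_y, y_mul_x, sub_smul, Nat.cast_smul_eq_nsmul]
  refine (Submodule.smul_mem_iff _ (sub_ne_zero.2 hn.symm)).1 (sum_commutators ▸ ?_)
  exact Submodule.sum_mem _ fun i _ => commutatorLieAlgebra.mul_sub_mul_mem _ _

theorem one_mem_commutatorLieAlgebra_matrix_iff [n.AtLeastTwo] :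
    (1 : Matrix ι ι (LeavittAlgebra K n)) ∈ commutatorLieAlgebra K _ ↔
      (Fintype.card ι : K) = 0 ∨ (n : K) ≠ 1 := by
  rw [commutatorLieAlgebra.mem_matrix_iff_trace_mem, Matrix.trace_one, ← nsmul_one,
    ← Nat.cast_smul_eq_nsmul K, ← one_mem_commutatorLieAlgebra_iff]
  by_cases hι : (Fintype.card ι : K) = 0
  · simp [hι, zero_mem]
  · rw [or_iff_right hι]
    exact Submodule.smul_mem_iff (commutatorLieAlgebra K _).toSubmodule hι

variable (K n) in
/-- The isomorphism `L_K(n) ≃ M_n(L_K(n))` that sends `a` to the matrix `(y i * a * x j)`. -/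
noncomputable def algEquivMatrix :
    LeavittAlgebra K n ≃ₐ[K] Matrix (Fin n) (Fin n) (LeavittAlgebra K n) where
  toFun a := Matrix.of fun i j => y K i * a * x K j
  invFun A := ∑ i, ∑ j, x K i * A i j * y K j
  left_inv a := calc
    ∑ i, ∑ j, x K i * (y K i * a * x K j) * y K j
        = (∑ i, x K i * y K i) * a * ∑ j, x K j * y K j := by
      simp only [Finset.sum_mul, Finset.mul_sum, mul_assoc]
      exact Finset.sum_comm
    _ = a := by rw [sum_x_mul_y, one_mul, mul_one]
  right_inv A := by
    ext i j
    calc y K i * (∑ k, ∑ l, x K k * A k l * y K l) * x K j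
        = ∑ k, ∑ l, (y K i * x K k) * A k l * (y K l * x K j) := by
          simp only [Finset.sum_mul, Finset.mul_sum, mul_assoc]
      _ = A i j := by simp [y_mul_x]
  map_mul' a b := by
    ext i j
    calc y K i * (a * b) * x K j
        = y K i * a * (∑ k, x K k * y K k) * (b * x K j) := by
          rw [sum_x_mul_y]; simp only [mul_one, mul_assoc]
      _ = ∑ k, (y K i * a * x K k) * (y K k * b * x K j) := by
          simp only [Finset.sum_mul, Finset.mul_sum, mul_assoc]
  map_add' a b := by ext; simp [mul_add, add_mul]
  commutes' c := by
    ext i j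
    simp [Algebra.algebraMap_eq_smul_one, y_mul_x, Matrix.one_apply]

variable (K n ι) in
/-- The isomorphism `M_ι(L_K(n)) ≃ M_{ι × n × n}(L_K(n))`. It makes the simplicity criterion for
matrices of size at least three available at every positive size. -/
noncomputable def matrixAlgEquiv :
    Matrix ι ι (LeavittAlgebra K n) ≃ₐ[K]
      Matrix ((ι × Fin n) × Fin n) ((ι × Fin n) × Fin n) (LeavittAlgebra K n) :=
  ((algEquivMatrix K n).mapMatrix.trans (Matrix.compAlgEquiv ι (Fin n) _ K)).trans
    ((algEquivMatrix K n).mapMatrix.trans (Matrix.compAlgEquiv (ι × Fin n) (Fin n) _ K))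

theorem isSimple_commutatorLieAlgebra_matrix_iff [hn : n.AtLeastTwo] :
    LieAlgebra.IsSimple K (commutatorLieAlgebra K (Matrix ι ι (LeavittAlgebra K n))) ↔
      (1 : Matrix ι ι (LeavittAlgebra K n)) ∉ commutatorLieAlgebra K _ := by
  refine ⟨commutatorLieAlgebra.one_notMem_of_isSimple, fun h1 => ?_⟩
  have : Nonempty ι := by
    by_contra hι
    rw [not_nonempty_iff] at hι
    exact h1 (Subsingleton.elim 0 (1 : Matrix ι ι (LeavittAlgebra K n)) ▸ zero_mem _)
  have three_le_card : 3 ≤ ENat.card ((ι × Fin n) × Fin n) := by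
    have one_le_card : 1 ≤ Fintype.card ι := Fintype.card_pos
    simp only [ENat.card_eq_coe_fintype_card, Fintype.card_prod, Fintype.card_fin]
    exact_mod_cast show 3 ≤ Fintype.card ι * n * n by
      nlinarith [Nat.mul_le_mul one_le_card hn.prop, hn.prop]
  refine commutatorLieAlgebra.isSimple_of_algEquiv (matrixAlgEquiv K n ι)
    (commutatorLieAlgebra.isSimple_matrix_of_one_notMem three_le_card fun h => h1 ?_)
  simpa using commutatorLieAlgebra.map_mem (matrixAlgEquiv K n ι).symm.toAlgHom h

end Main

end LeavittAlgebra

theorem corollary3p11 (K : Type*) [Field K] (n d : ℕ) (hn : 2 ≤ n) (hd : 1 ≤ d) :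
    LieAlgebra.IsSimple K
        (commutatorLieAlgebra K (Matrix (Fin d) (Fin d) (LeavittAlgebra K n))) ↔
      ringChar K ∣ n - 1 ∧ ¬ ringChar K ∣ d := by
  have : n.AtLeastTwo := ⟨hn⟩
  have dvd_sub_one_iff : ringChar K ∣ n - 1 ↔ (n : K) = 1 := by
    rw [← ringChar.spec, Nat.cast_sub (by omega), Nat.cast_one, sub_eq_zero]
  rw [LeavittAlgebra.isSimple_commutatorLieAlgebra_matrix_iff,
    LeavittAlgebra.one_mem_commutatorLieAlgebra_matrix_iff, Fintype.card_fin, dvd_sub_one_iff,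
    ← ringChar.spec, not_or, not_not, and_comm]
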